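/- Let a finite group $G$ act on a set $\Omega$. A subset $S\subseteq G$ is \emph{intersecting} if for all $\pi,\sigma\in S$ there is a point $x\in\Omega$ that $\pi$ and $\sigma$ map to the same point. The group $G$ has the \emph{EKR property} (with respect to this action) if the size of every intersecting subset of $G$ is at most the size of the largest point-stabilizer $G_x$, $x\in\Omega$. It has the \emph{strict EKR property} if, in addition, every intersecting subset of $G$ of maximum size is a coset of a point-stabilizer. A permutation group $G\le \mathrm{Sym}(n)$ is always considered with its natural action on $[n]=\{1,\dots,n\}$, where $n\ge 1$. For $G\le\mathrm{Sym}(m)$ and $H\le\mathrm{Sym}(n)$ with $m,n\ge 1$, let $G\wr H$ be the wreath product: its elements are the tuples $(g_1,\dots,g_n,h)$ with $g_1,\dots,g_n\in G$ and $h\in H$, and it acts on $[m]\times[n]$ by the imprimitive action $$(g_1,\dots,g_n,h)\colon (x,j)\mapsto (g_j(x),h(j)),$$ its multiplication being the corresponding composition of maps. \textbf{Theorem.} (1) If $G\le \mathrm{Sym}(m)$ and $H\le \mathrm{Sym}(n)$ have the EKR property, then $G\wr H$, acting on $[m]\times[n]$, has the EKR property. (2) For all $m,n\ge 1$, the group $\mathrm{Sym}(m)\wr\mathrm{Sym}(n)$,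 acting on $[m]\times[n]$, has the EKR property; if moreover $m\ge 4$, then it has the strict EKR property. -/

import Mathlib

open scoped Pointwise

/-- Two elements of a group acting on `Ω` intersect if they send some point to the same point;
a set is intersecting if any two of its elements intersect. -/
def IsIntersecting {G : Type*} (Ω : Type*) [Group G] [MulAction G Ω] (S : Set G) : Prop :=
  ∀ π ∈ S, ∀ σ ∈ S, ∃ x : Ω, π • x = σ • x

/-- An intersecting set of the largest possible size. -/
def IsMaximumIntersecting {G : Type*} (Ω : Type*) [Group G] [Finite G] [MulAction G Ω]
    (S : Set G) : Prop :=
  IsIntersecting Ω S ∧ ∀ T : Set G, IsIntersecting Ω T → T.ncard ≤ S.ncard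

/-- The EKR property of a finite group acting on `Ω`: every intersecting set is at most as large
as some (equivalently, the largest) point-stabilizer. -/
def HasEKR (G Ω : Type*) [Group G] [Finite G] [MulAction G Ω] : Prop :=
  ∃ x : Ω, ∀ S : Set G, IsIntersecting Ω S → S.ncard ≤ Nat.card (MulAction.stabilizer G x)

/-- The strict EKR property: the EKR property holds and every maximum intersecting set is a coset
of a point-stabilizer. (Left and right cosets of point-stabilizers form the same family, as
`G_x g = g G_{g⁻¹ x}`.) -/
def HasStrictEKR (G Ω : Type*) [Group G] [Finite G] [MulAction G Ω] : Prop :=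
  HasEKR G Ω ∧ ∀ S : Set G, IsMaximumIntersecting Ω S →
    ∃ (x : Ω) (g : G), S = g • (MulAction.stabilizer G x : Set G)

/-- The wreath product `G ≀ H`, where `H` acts on the index set `ι`: its elements are the pairs of
a family `(g_j)_{j ∈ ι}` of elements of `G` and an element `h` of `H`. -/
@[ext]
structure WreathProduct (G H ι : Type*) where
  base : ι → G
  top : H

namespace WreathProduct

variable {G H ι : Type*} [Group G] [Group H]

instance : One (WreathProduct G H ι) := ⟨⟨fun _ => 1, 1⟩⟩

theorem one_base (j : ι) : (1 : WreathProduct G H ι).base j = 1 := rfl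

theorem one_top : (1 : WreathProduct G H ι).top = 1 := rfl

variable [MulAction H ι]

/-- The multiplication `(g, h) (g', h') = ((g_{h' j} g'_j)_j, h h')`. Products are composed as
functions, the right factor first. -/
instance : Mul (WreathProduct G H ι) :=
  ⟨fun a b => ⟨fun j => a.base (b.top • j) * b.base j, a.top * b.top⟩⟩

instance : Inv (WreathProduct G H ι) :=
  ⟨fun a => ⟨fun j => (a.base (a.top⁻¹ • j))⁻¹, a.top⁻¹⟩⟩

theorem mul_base (a b : WreathProduct G H ι) (j : ι) :
    (a * b).base j = a.base (b.top • j) * b.base j := rfl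

theorem mul_top (a b : WreathProduct G H ι) : (a * b).top = a.top * b.top := rfl

theorem inv_base (a : WreathProduct G H ι) (j : ι) :
    a⁻¹.base j = (a.base (a.top⁻¹ • j))⁻¹ := rfl

theorem inv_top (a : WreathProduct G H ι) : a⁻¹.top = a.top⁻¹ := rfl

instance : Group (WreathProduct G H ι) :=
  Group.ofLeftAxioms
    (fun a b c => by
      ext j
      · simp only [mul_base, mul_top, mul_smul, mul_assoc]
      · simp only [mul_top, mul_assoc])
    (fun a => by
      ext j
      · simp only [mul_base, one_base, one_mul]
      · simp only [mul_top, one_top, one_mul])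
    (fun a => by
      ext j
      · simp only [mul_base, inv_base, one_base, inv_smul_smul, inv_mul_cancel]
      · simp only [mul_top, inv_top, one_top, inv_mul_cancel])

/-- The imprimitive action `(g, h) • (x, j) = (g_j x, h j)` on `X × ι`. -/
instance {X : Type*} [MulAction G X] : MulAction (WreathProduct G H ι) (X × ι) where
  smul a p := (a.base p.2 • p.1, a.top • p.2)
  one_smul p := Prod.ext (one_smul G p.1) (one_smul H p.2)
  mul_smul a b p := Prod.ext (mul_smul (a.base (b.top • p.2)) (b.base p.2) p.1)
    (mul_smul a.top b.top p.2)

theorem smul_mk {X : Type*} [MulAction G X] (a : WreathProduct G H ι) (x : X) (j : ι) :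
    a • (x, j) = (a.base j • x, a.top • j) := rfl

instance {G H ι : Type*} [Finite G] [Finite H] [Finite ι] : Finite (WreathProduct G H ι) :=
  Finite.of_injective (fun a => (a.base, a.top))
    (fun _ _ h => WreathProduct.ext (congrArg Prod.fst h) (congrArg Prod.snd h))

end WreathProduct

/-! Upper bounds come from double counting: if every translate of a family indexed by `κ` meets `S`
in at most `b` members, then `|κ| |S| ≤ |Γ| b`. For (1), the top components of an intersecting set
intersect in `H`, and the fibre over each top is tested against translates of the diagonal copy of
`G`, which meet it in intersecting subsets of `G`. For symmetric groups and their powers the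
families are Latin squares and `b = 1`.

For strictness, equality in this bound makes `S` meet every Latin square. Exchanging entries between
two rows of a square gives the switching principle `mem_or_mem_of_switch`, which yields the case of
one symmetric group (`exists_forall_apply_eq`) and, through a coordinate that controls membership,
the case of a power (`exists_forall_mem_iff`). In the wreath product, maximality makes the set of
tops and every fibre over it extremal. Fibres therefore have the form `g i x = y`, and comparing
fibres shows that `i`, `x`, `y` can be chosen independently of the top. -/

/-! ### Latin rectangles and idempotent Latin squares -/

-- Hall's theorem applies because the graph of allowed pairs is regular: `x` loses the values `K k
-- x` and `y` loses the points `(K k)⁻¹ y`, which are `#s` many in both cases.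
open Equiv Finset in
theorem Equiv.Perm.exists_disagree_of_card_lt {α κ : Type*} [Fintype α] [DecidableEq α]
    (s : Finset κ) (K : κ → Perm α)
    (hK : ∀ k ∈ s, ∀ l ∈ s, k ≠ l → ∀ x, K k x ≠ K l x) (hs : #s < Fintype.card α) :
    ∃ d : Perm α, ∀ k ∈ s, ∀ x, K k x ≠ d x := by
  classical
  let t : α → Finset α := fun x => univ \ s.image fun k => K k x
  have ht : ∀ x, #(t x) = Fintype.card α - #s := fun x => by
    rw [card_sdiff_of_subset (subset_univ _), card_univ, card_image_of_injOn]
    intro k hk l hl h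
    by_contra hne
    exact hK k hk l hl hne x h
  have hall : ∀ u : Finset α, #u ≤ #(u.biUnion t) := by
    intro u
    have h := card_mul_le_card_mul (s := u) (t := u.biUnion t) (fun x y => y ∈ t x)
      (m := Fintype.card α - #s) (n := Fintype.card α - #s) ?_ ?_
    · exact Nat.le_of_mul_le_mul_right h (by omega)
    · intro x hx
      rw [← ht x]
      refine card_le_card fun y hy => ?_
      exact (mem_bipartiteAbove _).2 ⟨mem_biUnion.2 ⟨x, hx, hy⟩, hy⟩
    · intro y _
      have h1 : #(univ \ s.image fun k => (K k)⁻¹ y) = Fintype.card α - #s := by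
        rw [card_sdiff_of_subset (subset_univ _), card_univ, card_image_of_injOn]
        intro k hk l hl h
        by_contra hne
        have h' : (K k)⁻¹ y = (K l)⁻¹ y := h
        apply hK k hk l hl hne ((K k)⁻¹ y)
        conv_rhs => rw [h']
        simp
      rw [← h1]
      refine card_le_card fun x hx => ?_
      have hx' := ((mem_bipartiteBelow _).1 hx).2
      simp only [t, mem_sdiff, mem_univ, true_and, mem_image, not_exists, not_and] at hx' ⊢
      intro k hk h
      exact hx' k hk (by rw [← h]; simp)
  obtain ⟨f, hf, hft⟩ := (all_card_le_biUnion_card_iff_exists_injective t).1 hall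
  refine ⟨Equiv.ofBijective f (Finite.injective_iff_bijective.1 hf), fun k hk x h => ?_⟩
  have := hft x
  simp only [t, mem_sdiff, mem_univ, true_and, mem_image, not_exists, not_and] at this
  exact this k hk h

-- Hall's condition: each point has at least two allowed values, and each value is forbidden at no
-- more than two points, so three points together reach every value.
open Equiv Finset in
theorem Equiv.Perm.exists_disagree_two {α : Type*} [Fintype α] [DecidableEq α]
    (hα : 4 ≤ Fintype.card α) (g₁ g₂ : Perm α) :
    ∃ d : Perm α, ∀ x, d x ≠ g₁ x ∧ d x ≠ g₂ x := by
  let t : α → Finset α := fun x => univ \ {g₁ x, g₂ x}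
  have hall : ∀ u : Finset α, #u ≤ #(u.biUnion t) := by
    intro u
    rcases u.eq_empty_or_nonempty with rfl | ⟨x, hx⟩
    · simp
    by_cases hu : #u ≤ 2
    · have h1 : #(t x) ≤ #(u.biUnion t) := card_le_card (subset_biUnion_of_mem t hx)
      have h2 : Fintype.card α - 2 ≤ #(t x) := by
        rw [card_sdiff_of_subset (subset_univ _), card_univ]
        have := card_le_two (a := g₁ x) (b := g₂ x)
        omega
      omega
    · have : u.biUnion t = univ := by
        refine eq_univ_of_forall fun y => ?_
        have : ∃ x ∈ u, x ∉ ({g₁⁻¹ y, g₂⁻¹ y} : Finset α) := by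
          by_contra! hcon
          have h1 := card_le_card (show u ⊆ _ from hcon)
          have := card_le_two (a := g₁⁻¹ y) (b := g₂⁻¹ y)
          omega
        obtain ⟨x, hx, hxy⟩ := this
        refine mem_biUnion.2 ⟨x, hx, ?_⟩
        simp only [t, mem_sdiff, mem_univ, true_and, mem_insert, mem_singleton, not_or] at hxy ⊢
        exact ⟨fun h => hxy.1 (by rw [h]; simp), fun h => hxy.2 (by rw [h]; simp)⟩
      rw [this]
      exact card_le_univ u
  obtain ⟨f, hf, hft⟩ := (all_card_le_biUnion_card_iff_exists_injective t).1 hall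
  refine ⟨Equiv.ofBijective f (Finite.injective_iff_bijective.1 hf), fun x => ?_⟩
  have := hft x
  simp only [t, mem_sdiff, mem_univ, true_and, mem_insert, mem_singleton, not_or] at this
  exact this

open Equiv Finset in
/-- Every Latin rectangle can be completed to a Latin square. -/
theorem Equiv.Perm.exists_latin_completion {α κ : Type*} [Fintype α] [DecidableEq α]
    [Fintype κ] [DecidableEq κ] (hκ : Fintype.card κ = Fintype.card α)
    (s : Finset κ) (K : κ → Perm α)
    (hK : ∀ k ∈ s, ∀ l ∈ s, k ≠ l → ∀ x, K k x ≠ K l x) :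
    ∃ L : κ → Perm α, (∀ k ∈ s, L k = K k) ∧ ∀ k l, k ≠ l → ∀ x, L k x ≠ L l x := by
  have key : ∀ t : Finset κ, ∃ L : κ → Perm α, (∀ k ∈ s, L k = K k) ∧
      ∀ k ∈ s ∪ t, ∀ l ∈ s ∪ t, k ≠ l → ∀ x, L k x ≠ L l x := by
    intro t
    induction t using Finset.induction_on with
    | empty => exact ⟨K, fun _ _ => rfl, by simpa using hK⟩
    | insert a t _ ih =>
      obtain ⟨L, hL, hL'⟩ := ih
      by_cases ha : a ∈ s ∪ t
      · have : s ∪ insert a t = s ∪ t := by rw [union_insert, insert_eq_of_mem ha]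
        exact ⟨L, hL, by rwa [this]⟩
      · have hlt : #(s ∪ t) < Fintype.card α := by
          rw [← hκ]
          exact card_lt_univ_of_notMem ha
        obtain ⟨d, hd⟩ := exists_disagree_of_card_lt (s ∪ t) L hL' hlt
        refine ⟨Function.update L a d, fun k hk => ?_, fun k hk l hl hkl x => ?_⟩
        · rw [Function.update_of_ne, hL k hk]
          rintro rfl
          exact ha (mem_union_left _ hk)
        · rw [union_insert, mem_insert] at hk hl
          rcases eq_or_ne k a with rfl | hka
          · have hl' := hl.resolve_left (Ne.symm hkl)
            rw [Function.update_self, Function.update_of_ne (Ne.symm hkl)]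
            exact (hd l hl' x).symm
          · rcases eq_or_ne l a with rfl | hla
            · rw [Function.update_self, Function.update_of_ne hka]
              exact hd k (hk.resolve_left hka) x
            · rw [Function.update_of_ne hka, Function.update_of_ne hla]
              exact hL' k (hk.resolve_left hka) l (hl.resolve_left hla) hkl x
  obtain ⟨L, hL, hL'⟩ := key univ
  exact ⟨L, hL, fun k l => hL' k (by simp) l (by simp)⟩

-- On `ZMod N` the rows `x ↦ 2x - r` form an idempotent square. It is prolonged along the
-- transversal `x = r + 1`: the entry `r + 2` there moves to the new column and new row, and `none`
-- replaces it.
open Equiv in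
theorem exists_idempotent_latin_option_zmod {N : ℕ} [NeZero N] (hN : Odd N) (h1 : 1 < N) :
    ∃ σ : Option (ZMod N) → Perm (Option (ZMod N)), (∀ r x, σ r x = x → x = r) ∧
      ∀ r s, r ≠ s → ∀ x, σ r x ≠ σ s x := by
  classical
  have : Fact (1 < N) := ⟨h1⟩
  let u : (ZMod N)ˣ := ZMod.unitOfCoprime 2 (Nat.coprime_two_left.2 hN)
  have hu : (u : ZMod N) = 2 := by simp [u]
  have two : ∀ a b : ZMod N, 2 * a = 2 * b → a = b := fun a b h => by
    rw [← hu] at h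
    exact u.mul_right_inj.1 h
  let τ : ZMod N → Perm (ZMod N) := fun r => (Units.mulLeft u).trans (Equiv.subRight r)
  have hτ : ∀ r x, τ r x = 2 * x - r := fun r x => by simp [τ, hu]
  let σ : Option (ZMod N) → Perm (Option (ZMod N)) := fun r =>
    r.elim (optionCongr (Equiv.addRight 1))
      fun r => (optionCongr (τ r)).trans (swap none (some (r + 2)))
  have h_nn : σ none none = none := by simp [σ]
  have h_ns : ∀ y, σ none (some y) = some (y + 1) := fun y => by simp [σ]
  have h_sn : ∀ r, σ (some r) none = some (r + 2) := fun r => by simp [σ]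
  have h_ss : ∀ r y, (σ (some r) (some y) = none ∧ y = r + 1) ∨
      (σ (some r) (some y) = some (2 * y - r) ∧ y ≠ r + 1) := by
    intro r y
    by_cases h : y = r + 1
    · left
      refine ⟨?_, h⟩
      have : 2 * (r + 1) - r = r + 2 := by ring
      simp [σ, hτ, h, this]
    · right
      refine ⟨?_, h⟩
      have : 2 * y - r ≠ r + 2 := fun h' => h (two _ _ (by linear_combination h'))
      simp only [σ, Option.elim, trans_apply, optionCongr_apply, Option.map_some, hτ]
      exact swap_apply_of_ne_of_ne (by simp) (by simpa using this)
  have h_n : ∀ r x, σ none x ≠ σ (some r) x := by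
    rintro r (_ | y)
    · rw [h_nn, h_sn]; simp
    · rw [h_ns]
      rcases h_ss r y with ⟨h, _⟩ | ⟨h, h'⟩ <;> rw [h]
      · simp
      · intro hh
        rw [Option.some_inj] at hh
        exact h' (by linear_combination -hh)
  refine ⟨σ, ?_, ?_⟩
  · rintro (_ | r) (_ | y) h
    · rfl
    · rw [h_ns, Option.some_inj] at h
      simp at h
    · rw [h_sn] at h
      simp at h
    · rcases h_ss r y with ⟨h', _⟩ | ⟨h', _⟩ <;> rw [h'] at h
      · simp at h
      · rw [Option.some_inj] at h ⊢
        linear_combination h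
  · rintro (_ | r) (_ | s) hrs x
    · simp at hrs
    · exact h_n s x
    · exact (h_n r x).symm
    · have hrs' : r ≠ s := by simpa using hrs
      rcases x with _ | y
      · rw [h_sn, h_sn]; simpa using hrs'
      · rcases h_ss r y with ⟨h, h'⟩ | ⟨h, h'⟩ <;> rcases h_ss s y with ⟨k, k'⟩ | ⟨k, k'⟩ <;>
          rw [h, k]
        · exact fun _ => hrs' (add_right_cancel (h'.symm.trans k'))
        · simp
        · simp
        · simpa using hrs'

open Equiv in
theorem exists_idempotent_latin_zmod {N : ℕ} (hN : Odd N) :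
    ∃ σ : ZMod N → Perm (ZMod N), (∀ r x, σ r x = x → x = r) ∧
      ∀ r s, r ≠ s → ∀ x, σ r x ≠ σ s x := by
  let u : (ZMod N)ˣ := ZMod.unitOfCoprime 2 (Nat.coprime_two_left.2 hN)
  have hu : (u : ZMod N) = 2 := by simp [u]
  refine ⟨fun r => (Units.mulLeft u).trans (Equiv.subRight r), fun r x h => ?_, fun r s h x => ?_⟩
  · have h : 2 * x - r = x := by simpa [hu] using h
    linear_combination h
  · simpa using h

open Equiv in
/-- There are idempotent Latin squares of every order at least three. -/
theorem exists_idempotent_latin {α : Type*} [Fintype α] (hα : 3 ≤ Fintype.card α) :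
    ∃ σ : α → Perm α, (∀ r x, σ r x = x → x = r) ∧ ∀ r s, r ≠ s → ∀ x, σ r x ≠ σ s x := by
  have transport : ∀ {β : Type} (_ : α ≃ β), (∃ σ : β → Perm β, (∀ r x, σ r x = x → x = r) ∧
      ∀ r s, r ≠ s → ∀ x, σ r x ≠ σ s x) →
      ∃ σ : α → Perm α, (∀ r x, σ r x = x → x = r) ∧ ∀ r s, r ≠ s → ∀ x, σ r x ≠ σ s x := by
    rintro β e ⟨σ, h1, h2⟩
    refine ⟨fun r => (e.trans (σ (e r))).trans e.symm, fun r x h => ?_, fun r s hrs x h => ?_⟩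
    · exact e.injective (h1 _ _ ((e.symm_apply_eq).1 h))
    · exact h2 (e r) (e s) (fun h => hrs (e.injective h)) (e x) (e.symm.injective h)
  rcases Nat.even_or_odd (Fintype.card α) with h | h
  · have : NeZero (Fintype.card α - 1) := ⟨by omega⟩
    refine transport (β := Option (ZMod (Fintype.card α - 1))) (Fintype.equivOfCardEq ?_)
      (exists_idempotent_latin_option_zmod (Nat.Even.sub_odd (by omega) h odd_one) (by omega))
    rw [Fintype.card_option, ZMod.card]
    omega
  · have : NeZero (Fintype.card α) := ⟨by omega⟩
    exact transport (Fintype.equivOfCardEq (by rw [ZMod.card])) (exists_idempotent_latin_zmod h)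

/-! ### Counting by translates, and maximum intersecting sets -/

/-- The pairs `(k, s)` are sorted by `v = s * (D k)⁻¹`; each `v` receives at most `b` of them. -/
theorem card_mul_ncard_le_of_translates {Γ κ : Type*} [Group Γ] [Finite Γ] [Finite κ]
    (S : Set Γ) (D : κ → Γ) (b : ℕ) (h : ∀ v, {k | v * D k ∈ S}.ncard ≤ b) :
    Nat.card κ * S.ncard ≤ Nat.card Γ * b := by
  have := Fintype.ofFinite Γ
  let e : κ × S ≃ Σ v : Γ, {k | v * D k ∈ S} :=
    { toFun := fun p => ⟨p.2 * (D p.1)⁻¹, p.1, by simp⟩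
      invFun := fun q => (q.2, ⟨q.1 * D q.2, q.2.2⟩)
      left_inv := fun p => by simp
      right_inv := fun ⟨v, k, hk⟩ => by
        have : v * D k * (D k)⁻¹ = v := by simp
        refine Sigma.ext this ?_
        dsimp only
        congr! 1
        rw [this] }
  rw [← Nat.card_coe_set_eq, ← Nat.card_prod, Nat.card_congr e, Nat.card_sigma,
    Nat.card_eq_fintype_card, ← Finset.card_univ, ← smul_eq_mul]
  exact Finset.sum_le_card_nsmul _ _ _ fun v _ => h v

theorem card_mul_ncard_le_of_clique {Γ κ : Type*} [Group Γ] [Finite Γ] [Finite κ]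
    (S : Set Γ) (K : κ → Γ) (h : ∀ v k l, v * K k ∈ S → v * K l ∈ S → k = l) :
    Nat.card κ * S.ncard ≤ Nat.card Γ := by
  rw [← mul_one (Nat.card Γ)]
  exact card_mul_ncard_le_of_translates S K 1 fun v =>
    (Set.ncard_le_one_iff (Set.toFinite _)).2 fun {k l} hk hl => h v k l hk hl

/-- The equality case: `(k, s) ↦ s * (K k)⁻¹` is injective, hence bijective by size, and so attains
`1`. -/
theorem exists_mem_of_clique {Γ κ : Type*} [Group Γ] [Finite Γ] [Finite κ]
    (S : Set Γ) (K : κ → Γ) (h : ∀ v k l, v * K k ∈ S → v * K l ∈ S → k = l)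
    (hS : Nat.card Γ ≤ Nat.card κ * S.ncard) : ∃ k, K k ∈ S := by
  let f : κ × S → Γ := fun p => p.2 * (K p.1)⁻¹
  have hf : Function.Injective f := by
    rintro ⟨k, s⟩ ⟨l, t⟩ hst
    have hst : (s : Γ) * (K k)⁻¹ = t * (K l)⁻¹ := hst
    have hkl : k = l := h (s * (K k)⁻¹) k l (by simp) (by rw [hst]; simp)
    subst hkl
    simpa [Subtype.ext_iff] using hst
  have hb : Function.Bijective f := by
    refine Function.Injective.bijective_of_nat_card_le hf ?_
    rwa [Nat.card_prod, Nat.card_coe_set_eq]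
  obtain ⟨⟨k, s⟩, hks⟩ := hb.2 1
  refine ⟨k, ?_⟩
  have : (s : Γ) = K k := mul_inv_eq_one.1 hks
  exact this ▸ s.2

theorem card_le_card_mul_stabilizer {Γ Ω : Type*} [Group Γ] [Finite Γ] [Finite Ω]
    [MulAction Γ Ω] (x : Ω) :
    Nat.card Γ ≤ Nat.card Ω * Nat.card (MulAction.stabilizer Γ x) := by
  rw [← Nat.card_congr (MulAction.orbitProdStabilizerEquivGroup Γ x), Nat.card_prod]
  exact Nat.mul_le_mul_right _ (Finite.card_subtype_le _)

theorem isIntersecting_setOf_smul_eq {Γ Ω : Type*} [Group Γ] [MulAction Γ Ω] (p q : Ω) :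
    IsIntersecting Ω {g : Γ | g • p = q} :=
  fun _ ha _ hb => ⟨p, ha.trans hb.symm⟩

theorem IsMaximumIntersecting.nonempty {Γ Ω : Type*} [Group Γ] [Finite Γ] [Nonempty Ω]
    [MulAction Γ Ω] {S : Set Γ} (hS : IsMaximumIntersecting Ω S) : S.Nonempty := by
  obtain ⟨x⟩ := ‹Nonempty Ω›
  have := hS.2 {1} fun a ha b hb => ⟨x, by rw [ha, hb]⟩
  rw [Set.ncard_singleton] at this
  exact Set.nonempty_of_ncard_ne_zero (by omega)

theorem IsMaximumIntersecting.card_le {Γ Ω : Type*} [Group Γ] [Finite Γ] [Finite Ω] [Nonempty Ω]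
    [MulAction Γ Ω] {S : Set Γ} (hS : IsMaximumIntersecting Ω S) :
    Nat.card Γ ≤ Nat.card Ω * S.ncard := by
  obtain ⟨x⟩ := ‹Nonempty Ω›
  exact (card_le_card_mul_stabilizer x).trans
    (Nat.mul_le_mul_left _ (hS.2 _ (isIntersecting_setOf_smul_eq x x)))

theorem IsMaximumIntersecting.eq_coset {Γ Ω : Type*} [Group Γ] [Finite Γ] [MulAction Γ Ω]
    {S : Set Γ} (hS : IsMaximumIntersecting Ω S) (hne : S.Nonempty) {p q : Ω}
    (h : ∀ g ∈ S, g • p = q) :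
    ∃ (x : Ω) (g : Γ), S = g • (MulAction.stabilizer Γ x : Set Γ) := by
  obtain ⟨g, hg⟩ := hne
  refine ⟨p, g, ?_⟩
  have h1 : g • (MulAction.stabilizer Γ p : Set Γ) = {w | w • p = q} := by
    ext w
    rw [Set.mem_smul_set_iff_inv_smul_mem, SetLike.mem_coe, MulAction.mem_stabilizer_iff,
      smul_eq_mul, mul_smul, inv_smul_eq_iff, h g hg, Set.mem_ofPred_eq]
  rw [h1]
  exact Set.eq_of_subset_of_ncard_le h (hS.2 _ (isIntersecting_setOf_smul_eq p q))

/-! ### The EKR property of wreath products -/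

section
variable {G H ι X : Type*} [Group G] [Group H] [MulAction H ι] [MulAction G X]

theorem ncard_eq_sum_fibres {G H ι : Type*} [Finite G] [Finite ι] [Fintype H] (S : Set (WreathProduct G H ι)) :
    S.ncard = ∑ h : H, {g : ι → G | (⟨g, h⟩ : WreathProduct G H ι) ∈ S}.ncard := by
  let e : S ≃ Σ h : H, {g : ι → G | (⟨g, h⟩ : WreathProduct G H ι) ∈ S} :=
    { toFun := fun w => ⟨w.1.top, w.1.base, w.2⟩
      invFun := fun q => ⟨⟨q.2, q.1⟩, q.2.2⟩
      left_inv := fun _ => rfl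
      right_inv := fun _ => rfl }
  rw [← Nat.card_coe_set_eq, Nat.card_congr e, Nat.card_sigma]
  rfl

theorem ncard_eq_sum_fibres_top {G H ι : Type*} [Finite G] [Finite ι] [Fintype H] (S : Set (WreathProduct G H ι)) :
    S.ncard = ∑ h ∈ (Set.toFinite (WreathProduct.top '' S)).toFinset,
      {g : ι → G | (⟨g, h⟩ : WreathProduct G H ι) ∈ S}.ncard := by
  rw [ncard_eq_sum_fibres]
  symm
  refine Finset.sum_subset (Finset.subset_univ _) fun h _ hh => ?_
  rw [Set.ncard_eq_zero]
  refine Set.eq_empty_of_forall_notMem fun g hg => hh ?_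
  rw [Set.Finite.mem_toFinset]
  exact ⟨_, hg, rfl⟩

theorem IsIntersecting.top {S : Set (WreathProduct G H ι)} (hS : IsIntersecting (X × ι) S) :
    IsIntersecting ι (WreathProduct.top '' S) := by
  rintro _ ⟨a, ha, rfl⟩ _ ⟨b, hb, rfl⟩
  obtain ⟨⟨x, j⟩, h⟩ := hS a ha b hb
  exact ⟨j, congrArg Prod.snd h⟩

theorem IsIntersecting.fibre {S : Set (WreathProduct G H ι)} (hS : IsIntersecting (X × ι) S)
    (h : H) {a b : ι → G} (ha : (⟨a, h⟩ : WreathProduct G H ι) ∈ S)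
    (hb : (⟨b, h⟩ : WreathProduct G H ι) ∈ S) : ∃ (i : ι) (x : X), a i • x = b i • x := by
  obtain ⟨⟨x, j⟩, h⟩ := hS _ ha _ hb
  exact ⟨j, x, congrArg Prod.fst h⟩

/-- To fix `(x, j)` the `j`-th entry must lie in the stabilizer of `x`; the entry it overwrites is
recorded in the factor `G`. The product form avoids division. -/
theorem card_mul_card_le_card_stabilizer [Finite G] [Finite H] [Finite ι] (x : X) (j : ι) :
    Nat.card (MulAction.stabilizer H j) *
      (Nat.card (ι → G) * Nat.card (MulAction.stabilizer G x)) ≤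
    Nat.card G * Nat.card (MulAction.stabilizer (WreathProduct G H ι) (x, j)) := by
  classical
  rw [← Nat.card_prod, ← Nat.card_prod, ← Nat.card_prod]
  refine Nat.card_le_card_of_injective
    (fun p => (p.2.1 j, ⟨⟨Function.update p.2.1 j p.2.2, p.1⟩, ?_⟩)) ?_
  · rw [MulAction.mem_stabilizer_iff, WreathProduct.smul_mk]
    refine Prod.ext ?_ p.1.2
    change Function.update p.2.1 j (p.2.2 : G) j • x = x
    rw [Function.update_self]
    exact p.2.2.2
  · rintro ⟨h, g, u⟩ ⟨h', g', u'⟩ hp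
    simp only [Prod.mk.injEq, Subtype.mk.injEq, WreathProduct.mk.injEq] at hp
    obtain ⟨h1, h2, h3⟩ := hp
    have hu : u = u' := Subtype.ext (by simpa using congrFun h2 j)
    have hg : g = g' := by
      funext k
      rcases eq_or_ne k j with rfl | hk
      · exact h1
      · simpa [hk] using congrFun h2 k
    rw [Subtype.ext h3, hg, hu]

theorem HasEKR.wreathProduct [Finite G] [Finite H] [Finite ι] (hG : HasEKR G X)
    (hH : HasEKR H ι) : HasEKR (WreathProduct G H ι) (X × ι) := by
  obtain ⟨x, hx⟩ := hG
  obtain ⟨j, hj⟩ := hH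
  refine ⟨(x, j), fun S hS => ?_⟩
  have := Fintype.ofFinite H
  have hfib : ∀ h : H, Nat.card G * {g : ι → G | (⟨g, h⟩ : WreathProduct G H ι) ∈ S}.ncard ≤
      Nat.card (ι → G) * Nat.card (MulAction.stabilizer G x) := by
    intro h
    -- Translates of constant families: if `v * k` and `v * l` agree at `(i, y)`, cancelling `v i`
    -- makes `k` and `l` agree at `y`.
    refine card_mul_ncard_le_of_translates _ (fun g _ => g) _ fun v => hx _ ?_
    intro a ha b hb
    obtain ⟨i, y, hy⟩ := hS.fibre h ha hb
    refine ⟨y, ?_⟩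
    simpa [mul_smul] using hy
  refine Nat.le_of_mul_le_mul_left ?_ (Nat.card_pos (α := G))
  refine le_trans ?_ (card_mul_card_le_card_stabilizer x j)
  rw [ncard_eq_sum_fibres_top, Finset.mul_sum]
  refine (Finset.sum_le_card_nsmul _ _ _ fun h _ => hfib h).trans ?_
  rw [smul_eq_mul]
  refine Nat.mul_le_mul_right _ ?_
  rw [← Set.ncard_eq_toFinset_card]
  exact hj _ hS.top
end

/-! ### Switching, and the extremal sets in a symmetric group -/

open Equiv in
/-- If a set of families of permutations is intersecting and meets every Latin square of families,
then it cannot be left by switching within a pair of families that disagree everywhere. -/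
theorem Equiv.Perm.mem_or_mem_of_switch {α ι : Type*} [Fintype α] [Nontrivial α]
    {S : Set (ι → Perm α)}
    (hS : ∀ a ∈ S, ∀ b ∈ S, ∃ i x, a i x = b i x)
    (hK : ∀ K : α → ι → Perm α, (∀ k l, k ≠ l → ∀ i x, K k i x ≠ K l i x) → ∃ k, K k ∈ S)
    {a b a' b' : ι → Perm α} (ha : a ∈ S) (hab : ∀ i x, a i x ≠ b i x)
    (h : ∀ i x, (a' i x = a i x ∧ b' i x = b i x) ∨ (a' i x = b i x ∧ b' i x = a i x)) :
    a' ∈ S ∨ b' ∈ S := by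
  classical
  obtain ⟨k₀, k₁, h01⟩ := exists_pair_ne α
  have hL : ∀ i, ∃ L : α → Perm α, L k₀ = a i ∧ L k₁ = b i ∧
      ∀ k l, k ≠ l → ∀ x, L k x ≠ L l x := by
    intro i
    obtain ⟨L, h1, h2⟩ := exists_latin_completion rfl {k₀, k₁}
      (fun k => if k = k₀ then a i else b i) (by
        intro k hk l hl hkl x
        simp only [Finset.mem_insert, Finset.mem_singleton] at hk hl
        rcases hk with rfl | rfl <;> rcases hl with rfl | rfl
        · exact absurd rfl hkl
        · simpa [h01.symm] using hab i x
        · simpa [h01.symm] using (hab i x).symm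
        · exact absurd rfl hkl)
    exact ⟨L, by simpa using h1 k₀ (by simp), by simpa [h01.symm] using h1 k₁ (by simp), h2⟩
  choose L hL0 hL1 hL2 using hL
  -- Each column keeps its entries up to order, so `K` is again a Latin square. Its rows other than
  -- `k₀`, `k₁` disagree everywhere with `a` and so lie outside `S`.
  let K : α → ι → Perm α := fun k i => if k = k₀ then a' i else if k = k₁ then b' i else L i k
  have hK0 : K k₀ = a' := by funext i; simp [K]
  have hK1 : K k₁ = b' := by funext i; simp [K, h01.symm]
  have hK2 : ∀ k, k ≠ k₀ → k ≠ k₁ → K k = fun i => L i k := fun k hk hk' => by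
    funext i; simp [K, hk, hk']
  have d0 : ∀ k, k ≠ k₀ → ∀ i x, a i x ≠ L i k x := fun k hk i x => by
    rw [← hL0]; exact hL2 i _ _ hk.symm x
  have d1 : ∀ k, k ≠ k₁ → ∀ i x, b i x ≠ L i k x := fun k hk i x => by
    rw [← hL1]; exact hL2 i _ _ hk.symm x
  have e01 : ∀ i x, a' i x ≠ b' i x := fun i x => by
    rcases h i x with ⟨h1, h2⟩ | ⟨h1, h2⟩ <;> rw [h1, h2]
    · exact hab i x
    · exact (hab i x).symm
  have e0 : ∀ k, k ≠ k₀ → k ≠ k₁ → ∀ i x, a' i x ≠ L i k x := fun k hk hk' i x => by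
    rcases h i x with ⟨h1, _⟩ | ⟨h1, _⟩ <;> rw [h1]
    · exact d0 k hk i x
    · exact d1 k hk' i x
  have e1 : ∀ k, k ≠ k₀ → k ≠ k₁ → ∀ i x, b' i x ≠ L i k x := fun k hk hk' i x => by
    rcases h i x with ⟨_, h1⟩ | ⟨_, h1⟩ <;> rw [h1]
    · exact d1 k hk' i x
    · exact d0 k hk i x
  obtain ⟨k, hk⟩ := hK K (by
    intro k l hkl i x
    by_cases k0 : k = k₀
    · subst k0
      by_cases l1 : l = k₁
      · subst l1; rw [hK0, hK1]; exact e01 i x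
      · rw [hK0, hK2 l hkl.symm l1]; exact e0 l hkl.symm l1 i x
    by_cases k1 : k = k₁
    · subst k1
      by_cases l0 : l = k₀
      · subst l0; rw [hK0, hK1]; exact (e01 i x).symm
      · rw [hK1, hK2 l l0 hkl.symm]; exact e1 l l0 hkl.symm i x
    rw [hK2 k k0 k1]
    by_cases l0 : l = k₀
    · subst l0; rw [hK0]; exact (e0 k k0 k1 i x).symm
    by_cases l1 : l = k₁
    · subst l1; rw [hK1]; exact (e1 k k0 k1 i x).symm
    rw [hK2 l l0 l1]
    exact hL2 i k l hkl x)
  by_cases k0 : k = k₀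
  · subst k0; left; rwa [← hK0]
  by_cases k1 : k = k₁
  · subst k1; right; rwa [← hK1]
  rw [hK2 k k0 k1] at hk
  obtain ⟨i, x, hx⟩ := hS _ ha _ hk
  exact absurd hx (d0 k k0 i x)

open Equiv in
theorem Equiv.Perm.exists_latin_square (α : Type*) [Fintype α] [DecidableEq α] :
    ∃ L : α → Perm α, ∀ k l, k ≠ l → ∀ x, L k x ≠ L l x := by
  obtain ⟨L, _, hL⟩ := exists_latin_completion (κ := α) rfl ∅ (fun _ => (1 : Perm α)) (by simp)
  exact ⟨L, hL⟩

open Equiv in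
theorem Equiv.Perm.card_mul_ncard_le_of_forall_agree {α ι : Type*} [Fintype α] [Finite ι]
    {S : Set (ι → Perm α)} (hS : ∀ a ∈ S, ∀ b ∈ S, ∃ i x, a i x = b i x) :
    Nat.card α * S.ncard ≤ Nat.card (ι → Perm α) := by
  classical
  obtain ⟨L, hL⟩ := exists_latin_square α
  refine card_mul_ncard_le_of_clique S (fun k _ => L k) fun v k l hk hl => ?_
  by_contra hkl
  obtain ⟨i, x, h⟩ := hS _ hk _ hl
  exact hL k l hkl x ((v i).injective h)

open Equiv in
theorem Equiv.Perm.exists_mem_of_forall_disagree {α ι : Type*} [Fintype α] [Finite ι]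
    {S : Set (ι → Perm α)} (hS : ∀ a ∈ S, ∀ b ∈ S, ∃ i x, a i x = b i x)
    (hc : Nat.card (ι → Perm α) ≤ Nat.card α * S.ncard)
    (K : α → ι → Perm α) (hK : ∀ k l, k ≠ l → ∀ i x, K k i x ≠ K l i x) : ∃ k, K k ∈ S := by
  refine exists_mem_of_clique S K (fun v k l hk hl => ?_) hc
  by_contra hkl
  obtain ⟨i, x, h⟩ := hS _ hk _ hl
  exact hK k l hkl i x ((v i).injective h)

open Equiv Finset in
/-- A permutation whose support is a given set with at least two elements. -/
theorem Equiv.Perm.exists_support_eq {α : Type*} [Fintype α] [DecidableEq α] (A : Finset α)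
    (hA : 2 ≤ #A) : ∃ e : Perm α, e.support = A := by
  obtain ⟨f, hf, hfA⟩ := A.exists_cycleOn
  refine ⟨f, hfA.antisymm fun x hx => mem_support.2 ?_⟩
  exact hf.apply_ne (one_lt_card_iff_nontrivial.1 (by omega)) hx

open Equiv in
theorem Equiv.Perm.exists_derangement (α : Type*) [Fintype α] [DecidableEq α]
    (hα : 2 ≤ Fintype.card α) : ∃ c : Perm α, ∀ x, c x ≠ x := by
  obtain ⟨c, hc⟩ := exists_support_eq (Finset.univ : Finset α) hα
  exact ⟨c, fun x => mem_support.1 (by rw [hc]; simp)⟩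

-- After translating `a` to `1`, an idempotent Latin square supplies a member `σ p` whose only fixed
-- point is `p`. Every member must then fix `p`: one moving `p` could be switched to one of smaller
-- support still moving `p`, down to a transposition, which disagrees with `σ p`.
open Equiv Finset in
theorem Equiv.Perm.exists_forall_apply_eq {α : Type*} [Fintype α] [DecidableEq α]
    (hα : 3 ≤ Fintype.card α) {S : Set (Perm α)} (hS : IsIntersecting α S)
    (hc : Nat.card (Perm α) ≤ Nat.card α * S.ncard) {a : Perm α} (ha : a ∈ S) :
    ∃ p, ∀ g ∈ S, g p = a p := by
  have : Nontrivial α := Fintype.one_lt_card_iff_nontrivial.1 (by omega)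
  let T : Set (Unit → Perm α) := (fun f : Unit → Perm α => f ()) ⁻¹' S
  have hT : ∀ a ∈ T, ∀ b ∈ T, ∃ i x, a i x = b i x := fun a ha b hb =>
    ⟨(), hS _ ha _ hb⟩
  have hcT : Nat.card (Unit → Perm α) ≤ Nat.card α * T.ncard := by
    have h1 : Nat.card (Unit → Perm α) = Nat.card (Perm α) :=
      Nat.card_congr (Equiv.funUnique Unit (Perm α))
    have h2 : T.ncard = S.ncard :=
      Set.ncard_preimage_of_injective_subset_range (Equiv.funUnique Unit (Perm α)).injective
        fun x _ => (Equiv.funUnique Unit (Perm α)).surjective x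
    rwa [h1, h2]
  have hKT := exists_mem_of_forall_disagree hT hcT
  obtain ⟨σ, hσ, hσ'⟩ := exists_idempotent_latin hα
  obtain ⟨p, hp⟩ := hKT (fun r _ => a * σ r) fun k l hkl _ x h =>
    hσ' k l hkl x (a.injective h)
  have hp : a * σ p ∈ S := hp
  have hpp : σ p p = p := by
    obtain ⟨x, hx⟩ := hS _ hp _ ha
    have hx : σ p x = x := a.injective hx
    rwa [hσ p x hx] at hx
  have key : ∀ n, ∀ h : Perm α, #h.support = n → a * h ∈ S → h p = p := by
    intro n
    induction n using Nat.strong_induction_on with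
    | _ n ih =>
    intro h hn hhS
    by_contra hhp
    have hpB : p ∈ h.support := mem_support.2 hhp
    have hn2 : 2 ≤ n := hn ▸ two_le_card_support_of_ne_one (fun h1 => hhp (by simp [h1]))
    rcases hn2.eq_or_lt with h2 | h3
    · obtain ⟨x, hx⟩ := hS _ hhS _ hp
      have hx : h x = σ p x := a.injective hx
      have hsw : IsSwap h := card_support_eq_two.1 (by omega)
      have hhh : h (h p) = p := by
        obtain ⟨u, v, huv, rfl⟩ := hsw
        simp
      by_cases hxs : x ∈ h.support
      · have hsup : ({p, h p} : Finset α) = h.support := by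
          refine eq_of_subset_of_card_le ?_ ?_
          · intro y hy
            rcases mem_insert.1 hy with rfl | hy
            · exact hpB
            · rw [mem_singleton.1 hy]
              exact apply_mem_support.2 hpB
          · rw [card_pair (Ne.symm hhp)]; omega
        rw [← hsup, mem_insert, mem_singleton] at hxs
        rcases hxs with rfl | rfl
        · exact hhp (hx.trans hpp)
        · rw [hhh] at hx
          exact hhp ((σ p).injective (hx.symm.trans hpp.symm))
      · have hxh := notMem_support.1 hxs
        rw [hxh] at hx
        have : x = p := hσ p x hx.symm
        exact hxs (this ▸ hpB)
    -- Take `e₁`, `e₂` with complementary supports, `e₁` moving the support of `h` without `c`. Then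
    -- `e₂` disagrees everywhere with `h`, and switching `1` with `e₁ * e₂` forces `e₁` in. The
    -- fixed point `y` of `h` gives the support of `e₂` a second element besides `c`.
    · obtain ⟨c, hc, hcp⟩ := exists_mem_ne (s := h.support) (by omega) p
      obtain ⟨y, hy⟩ := hS _ hhS _ ha
      have hy : h y = y := a.injective hy
      have hyB : y ∉ h.support := notMem_support.2 hy
      obtain ⟨e₁, he₁⟩ := exists_support_eq (h.support.erase c)
        (by rw [card_erase_of_mem hc]; omega)
      obtain ⟨e₂, he₂⟩ := exists_support_eq (h.support.erase c)ᶜ (by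
        have : ({y, c} : Finset α) ⊆ (h.support.erase c)ᶜ := by
          intro z hz
          rcases mem_insert.1 hz with rfl | hz
          · simp [hy]
          · simp [mem_singleton.1 hz]
        have h2 := card_le_card this
        rwa [card_pair (by rintro rfl; exact hyB hc)] at h2)
      have m₁ : ∀ x, e₁ x ≠ x ↔ x ≠ c ∧ h x ≠ x := fun x => by
        rw [← mem_support, he₁, mem_erase, mem_support]
      have m₂ : ∀ x, e₂ x ≠ x ↔ ¬ (x ≠ c ∧ h x ≠ x) := fun x => by
        rw [← mem_support, he₂, mem_compl, mem_erase, mem_support]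
      have fix₁ : ∀ x, ¬ (x ≠ c ∧ h x ≠ x) → e₁ x = x := fun x hx => by
        by_contra hh; exact hx ((m₁ x).1 hh)
      have fix₂ : ∀ x, (x ≠ c ∧ h x ≠ x) → e₂ x = x := fun x hx => by
        by_contra hh; exact (m₂ x).1 hh hx
      have e₂S : a * e₂ ∉ S := by
        intro he
        obtain ⟨x, hx⟩ := hS _ hhS _ he
        have hx : h x = e₂ x := a.injective hx
        by_cases hxh : h x = x
        · exact (m₂ x).2 (fun h' => h'.2 hxh) (by rw [← hx, hxh])
        · by_cases hxc : x = c
          · have hm : e₂ x ∈ e₂.support := by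
              rw [apply_mem_support, mem_support, m₂]
              exact fun h' => h'.1 hxc
            rw [mem_support, m₂, ← hx] at hm
            refine hm ⟨fun h' => hxh (h'.trans hxc.symm), fun h' => hxh (h.injective h')⟩
          · exact hxh (hx.trans (fix₂ x ⟨hxc, hxh⟩))
      have := mem_or_mem_of_switch (S := T) hT hKT (a := fun _ => a) (b := fun _ => a * (e₁ * e₂))
        (a' := fun _ => a * e₁) (b' := fun _ => a * e₂) ha (fun _ x hx => by
          have hx : x = e₁ (e₂ x) := a.injective hx
          by_cases hxx : x ≠ c ∧ h x ≠ x
          · rw [fix₂ x hxx] at hx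
            exact (m₁ x).2 hxx hx.symm
          · have hm : e₂ x ∈ e₂.support := by
              rw [apply_mem_support, mem_support, m₂]
              exact hxx
            rw [mem_support, m₂] at hm
            rw [fix₁ _ hm] at hx
            exact (m₂ x).2 hxx hx.symm) (fun _ x => by
          by_cases hxx : x ≠ c ∧ h x ≠ x
          · right
            simp [fix₂ x hxx]
          · left
            have hm : e₂ x ∈ e₂.support := by
              rw [apply_mem_support, mem_support, m₂]
              exact hxx
            rw [mem_support, m₂] at hm
            simp [fix₁ x hxx, fix₁ _ hm])
      have he₁S : a * e₁ ∈ S := this.resolve_right e₂S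
      have h1 := ih _ (by rw [← hn]; exact card_erase_lt_of_mem hc) e₁ (by rw [he₁]) he₁S
      exact (m₁ p).2 ⟨Ne.symm hcp, hhp⟩ h1
  refine ⟨p, fun g hg => ?_⟩
  have := key _ (a⁻¹ * g) rfl (by simpa using hg)
  rw [Perm.mul_apply, Perm.inv_eq_iff_eq] at this
  exact this

/-! ### Extremal sets in powers of a symmetric group -/

open Equiv Finset in
/-- An element of a largest intersecting set of families determines a coordinate: families that
agree with it in that coordinate and disagree everywhere in the others belong to the set. -/
theorem Equiv.Perm.exists_dictator_coordinate {α ι : Type*} [Fintype α] [Fintype ι] [Nonempty ι]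
    (hα : 4 ≤ Fintype.card α) {S : Set (ι → Perm α)}
    (hS : ∀ a ∈ S, ∀ b ∈ S, ∃ i x, a i x = b i x)
    (hK : ∀ K : α → ι → Perm α, (∀ k l, k ≠ l → ∀ i x, K k i x ≠ K l i x) → ∃ k, K k ∈ S)
    {a : ι → Perm α} (ha : a ∈ S) :
    ∃ i, ∀ e : ι → Perm α, e i = a i → (∀ k, k ≠ i → ∀ x, e k x ≠ a k x) → e ∈ S := by
  classical
  have : Nontrivial α := Fintype.one_lt_card_iff_nontrivial.1 (by omega)
  obtain ⟨c, hc⟩ := exists_derangement α (by omega)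
  obtain ⟨c', hc'⟩ := exists_disagree_two hα 1 c
  simp only [Perm.one_apply] at hc'
  let u : Finset ι → ι → Perm α := fun J i => if i ∈ J then a i * c else a i
  have hu : u univ ∉ S := fun h => by
    obtain ⟨i, x, hx⟩ := hS _ h _ ha
    exact hc x ((a i).injective (by simpa [u] using hx))
  -- A minimal set of coordinates whose alteration by `c` leaves `S`; it turns out to be a single
  -- coordinate, the one sought.
  obtain ⟨M, hM, hmin⟩ := wellFounded_lt.has_min {M : Finset ι | u M ∉ S} ⟨univ, hu⟩
  have hM : u M ∉ S := hM
  have hmin : ∀ J, J ⊂ M → u J ∈ S := fun J hJ => by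
    by_contra h
    exact hmin J h hJ
  obtain ⟨i, hi⟩ : M.Nonempty := by
    rw [nonempty_iff_ne_empty]
    rintro rfl
    exact hM (by simpa [u] using ha)
  have hMi : M = {i} := by
    by_contra hne
    have hi' : ({i} : Finset ι) ⊂ M :=
      (singleton_subset_iff.2 hi).ssubset_of_ne (Ne.symm hne)
    have h1 := hmin _ hi'
    have h2 := hmin _ (erase_ssubset hi)
    -- Since `u M` is outside `S`, this switch puts `b'` inside, yet `b'` disagrees everywhere with
    -- `u {i}`. This needs `c'` to avoid both the identity and `c`.
    have h3 := mem_or_mem_of_switch hS hK h2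
      (b := fun k => if k = i then a k * c else a k * c')
      (a' := u M) (b' := fun k => if k = i then a k else a k * c')
      (fun k x => by
        by_cases hk : k = i
        · subst hk
          simpa [u] using (hc x).symm
        · by_cases hkM : k ∈ M
          · simpa [u, hk, hkM] using (hc' x).2.symm
          · simpa [u, hk, hkM] using (hc' x).1.symm)
      (fun k x => by
        by_cases hk : k = i
        · subst hk
          simp [u, hi]
        · by_cases hkM : k ∈ M <;> simp [u, hk, hkM])
    obtain ⟨k, x, hx⟩ := hS _ (h3.resolve_left hM) _ h1
    by_cases hk : k = i
    · simp [u, hk] at hx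
      exact hc x hx.symm
    · simp [u, hk] at hx
      exact (hc' x).1 hx
  refine ⟨i, fun e hei he => ?_⟩
  have := mem_or_mem_of_switch hS hK ha
    (b := fun k => if k = i then a k * c else e k) (a' := u M) (b' := e)
    (fun k x => by
      by_cases hk : k = i
      · simpa [hk] using (hc x).symm
      · simpa [hk] using (he k hk x).symm)
    (fun k x => by
      by_cases hk : k = i
      · subst hk
        simp [u, hMi, hei]
      · simp [u, hMi, hk])
  exact this.resolve_left hM

theorem card_mul_ncard_preimage_eval_le {G ι : Type*} [Finite G] [Finite ι] (i : ι) (T : Set G) :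
    Nat.card G * ((fun g : ι → G => g i) ⁻¹' T).ncard ≤ T.ncard * Nat.card (ι → G) := by
  classical
  rw [← Nat.card_coe_set_eq, ← Nat.card_coe_set_eq, ← Nat.card_prod, ← Nat.card_prod]
  refine Nat.card_le_card_of_injective
    (fun p => (⟨p.2.1 i, p.2.2⟩, Function.update p.2.1 i p.1)) ?_
  rintro ⟨u, g, hg⟩ ⟨u', g', hg'⟩ h
  simp only [Prod.mk.injEq, Subtype.mk.injEq] at h
  have hu : u = u' := by simpa using congrFun h.2 i
  have hgg : g = g' := by
    funext k
    rcases eq_or_ne k i with rfl | hk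
    · exact h.1
    · simpa [hk] using congrFun h.2 k
  subst hu hgg
  rfl

open Equiv Finset in
/-- The largest sets of families of permutations any two of which agree somewhere. -/
theorem Equiv.Perm.exists_forall_mem_iff {α ι : Type*} [Fintype α] [Fintype ι] [Nonempty ι]
    (hα : 4 ≤ Fintype.card α) {S : Set (ι → Perm α)}
    (hS : ∀ a ∈ S, ∀ b ∈ S, ∃ i x, a i x = b i x)
    (hc : Nat.card (ι → Perm α) ≤ Nat.card α * S.ncard) :
    ∃ i x y, ∀ g, g ∈ S ↔ g i x = y := by
  classical
  have hK := exists_mem_of_forall_disagree hS hc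
  have hd := fun a (ha : a ∈ S) => exists_dictator_coordinate hα hS hK ha
  choose D hD using fun g₁ g₂ : Perm α => exists_disagree_two hα g₁ g₂
  obtain ⟨a₀, ha₀⟩ : S.Nonempty := by
    refine Set.nonempty_of_ncard_ne_zero fun h => ?_
    rw [h, mul_zero] at hc
    exact absurd (Nat.card_pos (α := ι → Perm α)) (by omega)
  obtain ⟨i, hi⟩ := hd a₀ ha₀
  -- All members share the coordinate `i`: if `a` had `k ≠ i`, then `e`, controlled by `a₀` at `i`,
  -- and `e'`, controlled by `a` at `k`, would be members that never agree.
  have hcoord : ∀ a ∈ S, ∀ e : ι → Perm α, e i = a i →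
      (∀ k, k ≠ i → ∀ x, e k x ≠ a k x) → e ∈ S := by
    intro a ha
    obtain ⟨k, hk⟩ := hd a ha
    by_cases hki : k = i
    · rwa [← hki]
    exfalso
    let e : ι → Perm α := fun l => if l = i then a₀ l else D (a₀ l) (a l)
    have he : e ∈ S := hi e (by simp [e]) fun l hl x => by simpa [e, hl] using (hD _ _ x).1
    let e' : ι → Perm α := fun l => if l = k then a l else D (a l) (e l)
    have he' : e' ∈ S := hk e' (by simp [e']) fun l hl x => by simpa [e', hl] using (hD _ _ x).1
    obtain ⟨l, x, hx⟩ := hS _ he' _ he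
    by_cases hl : l = k
    · subst hl
      simp only [e', e, hki, if_true, if_false] at hx
      exact (hD _ _ x).2 hx.symm
    · simp only [e', hl, if_false] at hx
      exact (hD _ _ x).2 hx
  let T : Set (Perm α) := (fun g : ι → Perm α => g i) '' S
  -- Off `i`, `g` can be replaced by entries disagreeing with both `g` and `h` without leaving `S`,
  -- so the agreement with `h` occurs at `i`.
  have hT : IsIntersecting α T := by
    rintro _ ⟨g, hg, rfl⟩ _ ⟨h, hh, rfl⟩
    let e : ι → Perm α := fun l => if l = i then g l else D (g l) (h l)
    have he : e ∈ S :=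
      hcoord g hg e (by simp [e]) fun l hl x => by simpa [e, hl] using (hD _ _ x).1
    obtain ⟨l, x, hx⟩ := hS _ he _ hh
    by_cases hl : l = i
    · subst hl
      exact ⟨x, by simpa [e] using hx⟩
    · simp only [e, hl, if_false] at hx
      exact absurd hx (hD _ _ x).2
  have hST : S ⊆ (fun g : ι → Perm α => g i) ⁻¹' T := Set.subset_preimage_image _ _
  have hTc : Nat.card (Perm α) ≤ Nat.card α * T.ncard := by
    refine Nat.le_of_mul_le_mul_right ?_ (Nat.card_pos (α := ι → Perm α))
    calc Nat.card (Perm α) * Nat.card (ι → Perm α)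
        ≤ Nat.card (Perm α) * (Nat.card α * S.ncard) := Nat.mul_le_mul_left _ hc
      _ = Nat.card α * (Nat.card (Perm α) * S.ncard) := by ring
      _ ≤ Nat.card α * (T.ncard * Nat.card (ι → Perm α)) :=
        Nat.mul_le_mul_left _ ((Nat.mul_le_mul_left _ (Set.ncard_le_ncard hST)).trans
          (card_mul_ncard_preimage_eval_le i T))
      _ = Nat.card α * T.ncard * Nat.card (ι → Perm α) := by ring
  obtain ⟨x, hx⟩ := exists_forall_apply_eq (by omega) hT hTc (Set.mem_image_of_mem _ ha₀)
  have hSR : S ⊆ {g | g i x = a₀ i x} := fun g hg => hx _ (Set.mem_image_of_mem _ hg)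
  have hRc := card_mul_ncard_le_of_forall_agree (S := {g : ι → Perm α | g i x = a₀ i x})
    fun a ha b hb => ⟨i, x, Eq.trans ha (Eq.symm hb)⟩
  have hSR' := Set.eq_of_subset_of_ncard_le hSR
    (Nat.le_of_mul_le_mul_left (hRc.trans hc) (by rw [Nat.card_eq_fintype_card]; omega))
  exact ⟨i, x, a₀ i x, fun g => by rw [hSR']; rfl⟩

/-! ### The EKR property of symmetric groups, and separating permutations -/

open Equiv in
theorem IsIntersecting.card_mul_ncard_le {α : Type*} [Fintype α] {S : Set (Perm α)}
    (hS : IsIntersecting α S) : Nat.card α * S.ncard ≤ Nat.card (Perm α) := by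
  classical
  obtain ⟨L, hL⟩ := Perm.exists_latin_square α
  refine card_mul_ncard_le_of_clique S L fun v k l hk hl => ?_
  by_contra hkl
  obtain ⟨x, h⟩ := hS _ hk _ hl
  exact hL k l hkl x (v.injective h)

open Equiv in
theorem Equiv.Perm.hasEKR (α : Type*) [Fintype α] [Nonempty α] : HasEKR (Perm α) α := by
  obtain ⟨x⟩ := ‹Nonempty α›
  refine ⟨x, fun S hS => ?_⟩
  have : 0 < Nat.card α := Nat.card_pos_iff.2 ⟨⟨x⟩, inferInstance⟩
  exact Nat.le_of_mul_le_mul_left (hS.card_mul_ncard_le.trans (card_le_card_mul_stabilizer x)) this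

-- Choose `u` with `u x = y` and `u x' ≠ y'`, then `v = u * d` with `d` a derangement, conjugated so
-- that `d x' = u⁻¹ y'`. This separates two fibres with different constraints.
open Equiv in
theorem Equiv.Perm.exists_disagree_of_pair_ne {α : Type*} [Fintype α] [DecidableEq α]
    (hα : 3 ≤ Fintype.card α) {x y x' y' : α} (h : ¬ (x = x' ∧ y = y')) :
    ∃ u v : Perm α, u x = y ∧ v x' = y' ∧ ∀ z, u z ≠ v z := by
  obtain ⟨u, hu, hu'⟩ : ∃ u : Perm α, u x = y ∧ u x' ≠ y' := by
    by_cases hx : x = x'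
    · subst hx
      exact ⟨swap x y, swap_apply_left x y, by simpa using h⟩
    · by_cases hy : swap x y x' = y'
      · obtain ⟨z, hz⟩ := Finset.exists_mem_notMem_of_card_lt_card (s := {y, y'})
          (t := (Finset.univ : Finset α))
          (by have := Finset.card_le_two (a := y) (b := y'); rw [Finset.card_univ]; omega)
        simp only [Finset.mem_univ, true_and, Finset.mem_insert, Finset.mem_singleton,
          not_or] at hz
        have hyy : y ≠ y' := fun h' => hx ((swap x y).injective ((swap_apply_left x y).trans (h'.trans hy.symm)))
        refine ⟨swap y' z * swap x y, ?_, ?_⟩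
        · simp [swap_apply_of_ne_of_ne hyy (Ne.symm hz.1)]
        · simpa [hy] using hz.2
      · exact ⟨swap x y, swap_apply_left x y, hy⟩
  obtain ⟨c, hc⟩ := exists_derangement α (by omega)
  let w := u⁻¹ y'
  have hw : w ≠ x' := fun h' => hu' (by simp [← h', w])
  let d : Perm α := swap (c x') w * c * (swap (c x') w)⁻¹
  have hd : d x' = w := by
    have : (swap (c x') w)⁻¹ x' = x' := by
      rw [swap_inv]
      exact swap_apply_of_ne_of_ne (hc x').symm hw.symm
    simp only [d, Perm.mul_apply, this, swap_apply_left]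
  refine ⟨u, u * d, hu, by simp [hd, w], fun z hz => ?_⟩
  have hz : z = d z := u.injective hz
  apply hc ((swap (c x') w)⁻¹ z)
  conv_rhs => rw [hz]
  simp [d]

open Equiv in
theorem Equiv.Perm.eq_of_apply_eq_of_card_le_two {ι : Type*} [Fintype ι] [DecidableEq ι] (hι : Fintype.card ι ≤ 2)
    {g h : Perm ι} {j : ι} (hj : g j = h j) : g = h := by
  by_contra hne
  have h1 : h⁻¹ * g ≠ 1 := fun h' => hne (inv_mul_eq_one.1 h').symm
  have h2 := Perm.two_le_card_support_of_ne_one h1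
  have h3 : j ∉ (h⁻¹ * g).support := Perm.notMem_support.2 (by simp [hj])
  have := Finset.card_lt_univ_of_notMem h3
  omega

/-! ### Strictness for the wreath product -/

section
open Equiv

variable {α ι : Type*} [Fintype α] [Fintype ι] [Nonempty ι]

/-- The upper bounds for the number of tops and for each fibre multiply to the lower bound for `S`
given by a point-stabilizer, so none of them can be strict. -/
theorem IsMaximumIntersecting.card_le_top_and_card_le_fibre (hα : 0 < Fintype.card α)
    {S : Set (WreathProduct (Perm α) (Perm ι) ι)} (hS : IsMaximumIntersecting (α × ι) S) :
    Nat.card (Perm ι) ≤ Nat.card ι * (WreathProduct.top '' S).ncard ∧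
      ∀ h ∈ WreathProduct.top '' S, Nat.card (ι → Perm α) ≤ Nat.card α *
        {g : ι → Perm α | (⟨g, h⟩ : WreathProduct (Perm α) (Perm ι) ι) ∈ S}.ncard := by
  classical
  have : Nonempty α := Fintype.card_pos_iff.1 hα
  have hn : 0 < Nat.card ι := Nat.card_pos
  have hN : 0 < Nat.card (ι → Perm α) := Nat.card_pos
  have hcard := hS.card_le
  have hW : Nat.card (WreathProduct (Perm α) (Perm ι) ι) =
      Nat.card (ι → Perm α) * Nat.card (Perm ι) := by
    rw [← Nat.card_prod]
    exact Nat.card_congr ⟨fun w => (w.base, w.top), fun p => ⟨p.1, p.2⟩, fun _ => rfl, fun _ => rfl⟩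
  have hfib : ∀ h : Perm ι, Nat.card α *
      {g : ι → Perm α | (⟨g, h⟩ : WreathProduct (Perm α) (Perm ι) ι) ∈ S}.ncard ≤
        Nat.card (ι → Perm α) := fun h =>
    Perm.card_mul_ncard_le_of_forall_agree fun a ha b hb => hS.1.fibre h ha hb
  have htop := hS.1.top.card_mul_ncard_le
  rw [hW, Nat.card_prod, ncard_eq_sum_fibres_top, mul_comm (Nat.card α), mul_assoc,
    Finset.mul_sum] at hcard
  rw [Set.ncard_eq_toFinset_card] at htop ⊢
  set P := (Set.toFinite (WreathProduct.top '' S)).toFinset with hP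
  set N := Nat.card (ι → Perm α)
  have hle := Finset.sum_le_card_nsmul P _ N fun h _ => hfib h
  rw [smul_eq_mul] at hle
  refine ⟨?_, fun h hh => ?_⟩
  · refine Nat.le_of_mul_le_mul_left ?_ hN
    calc _ ≤ _ := hcard
      _ ≤ _ := Nat.mul_le_mul_left _ hle
      _ = _ := by ring
  · by_contra! hlt
    have hlt' := Finset.sum_lt_sum (s := P) (fun h _ => hfib h)
      ⟨h, by rwa [hP, Set.Finite.mem_toFinset], hlt⟩
    rw [Finset.sum_const, smul_eq_mul] at hlt'
    have h1 := Nat.mul_lt_mul_of_pos_left hlt' hn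
    have h2 := Nat.mul_le_mul_left N htop
    have h3 : N * (Nat.card ι * P.card) = Nat.card ι * (P.card * N) := by ring
    omega

theorem IsMaximumIntersecting.exists_smul_eq (hα : 4 ≤ Fintype.card α)
    {S : Set (WreathProduct (Perm α) (Perm ι) ι)} (hS : IsMaximumIntersecting (α × ι) S)
    (hne : S.Nonempty) : ∃ p q : α × ι, ∀ w ∈ S, w • p = q := by
  classical
  obtain ⟨hP, hF⟩ := hS.card_le_top_and_card_le_fibre (by omega)
  have hfib : ∀ h ∈ WreathProduct.top '' S, ∃ i x y, ∀ g : ι → Perm α,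
      (⟨g, h⟩ : WreathProduct (Perm α) (Perm ι) ι) ∈ S ↔ g i x = y := fun h hh =>
    Perm.exists_forall_mem_iff hα (fun a ha b hb => hS.1.fibre h ha hb) (hF h hh)
  obtain ⟨w₀, hw₀⟩ := hne
  have h₀ : w₀.top ∈ WreathProduct.top '' S := ⟨w₀, hw₀, rfl⟩
  obtain ⟨c, hc⟩ := Perm.exists_derangement α (by omega)
  -- With at most two indices, intersecting tops coincide, so there is only one fibre; otherwise the
  -- tops are determined by `exists_forall_apply_eq`.
  rcases le_or_gt (Fintype.card ι) 2 with hι | hι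
  · obtain ⟨i, x, y, hixy⟩ := hfib _ h₀
    refine ⟨(x, i), (y, w₀.top i), fun w hw => ?_⟩
    have htop : w.top = w₀.top := by
      obtain ⟨j, hj⟩ := hS.1.top _ ⟨w, hw, rfl⟩ _ h₀
      exact Perm.eq_of_apply_eq_of_card_le_two hι hj
    refine Prod.ext ?_ (congrArg (fun h : Perm ι => h i) htop)
    exact (hixy w.base).1 (by rw [← htop]; exact hw)
  · obtain ⟨j, hj⟩ := Perm.exists_forall_apply_eq hι hS.1.top hP h₀
    have hPeq : WreathProduct.top '' S = {h : Perm ι | h j = w₀.top j} := by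
      refine Set.eq_of_subset_of_ncard_le hj ?_
      have : IsIntersecting ι {h : Perm ι | h j = w₀.top j} :=
        isIntersecting_setOf_smul_eq j (w₀.top j)
      exact Nat.le_of_mul_le_mul_left (this.card_mul_ncard_le.trans hP) Nat.card_pos
    have hfib' : ∀ h ∈ WreathProduct.top '' S, ∃ x y, ∀ g : ι → Perm α,
        (⟨g, h⟩ : WreathProduct (Perm α) (Perm ι) ι) ∈ S ↔ g j x = y := by
      intro h hh
      obtain ⟨i, x, y, hixy⟩ := hfib h hh
      by_cases hij : i = j
      · subst hij
        exact ⟨x, y, hixy⟩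
      exfalso
      obtain ⟨k, hk⟩ := Finset.exists_mem_notMem_of_card_lt_card (s := {i, j})
        (t := (Finset.univ : Finset ι))
        (by have := Finset.card_le_two (a := i) (b := j); rw [Finset.card_univ]; omega)
      simp only [Finset.mem_univ, true_and, Finset.mem_insert, Finset.mem_singleton,
        not_or] at hk
      -- This top differs from `h` at `i`. The fibre over `h` constrains only coordinate `i`, so it
      -- has a member disagreeing everywhere else with a given `w` over the new top; the two never
      -- intersect.
      have hh' : h * swap i k ∈ WreathProduct.top '' S := by
        rw [hPeq]
        change h (swap i k j) = w₀.top j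
        rw [swap_apply_of_ne_of_ne (Ne.symm hij) (Ne.symm hk.2)]
        exact hj h hh
      obtain ⟨w, hw, hwt⟩ := hh'
      obtain ⟨⟨z, l⟩, hzl⟩ := hS.1 _
        ((hixy fun l => if l = i then swap x y else w.base l * c).2 (by simp)) _ hw
      have h1 : (if l = i then swap x y else w.base l * c) z = w.base l z :=
        congrArg Prod.fst hzl
      have h2 : h l = w.top l := congrArg Prod.snd hzl
      by_cases hl : l = i
      · subst hl
        rw [hwt, Perm.mul_apply, swap_apply_left] at h2
        exact hk.1 (h.injective h2).symm
      · rw [if_neg hl] at h1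
        exact hc z ((w.base l).injective h1)
    obtain ⟨x, y, hxy⟩ := hfib' _ h₀
    refine ⟨(x, j), (y, w₀.top j), fun w hw => ?_⟩
    have hwt : w.top ∈ WreathProduct.top '' S := ⟨w, hw, rfl⟩
    refine Prod.ext ?_ (hj _ hwt)
    obtain ⟨x', y', hxy'⟩ := hfib' _ hwt
    by_cases heq : x = x' ∧ y = y'
    · rw [heq.1, heq.2]
      exact (hxy' w.base).1 hw
    exfalso
    -- Different constraints at `j` would allow members of the two fibres that disagree at `j`
    -- through `u`, `v` and elsewhere through `1`, `c`.
    obtain ⟨u, v, hu, hv, huv⟩ := Perm.exists_disagree_of_pair_ne (by omega) heq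
    obtain ⟨⟨z, l⟩, hzl⟩ := hS.1 _
      ((hxy fun l => if l = j then u else 1).2 (by simpa using hu)) _
      ((hxy' fun l => if l = j then v else c).2 (by simpa using hv))
    have h1 : (if l = j then u else 1) z = (if l = j then v else c) z := congrArg Prod.fst hzl
    by_cases hl : l = j
    · rw [if_pos hl, if_pos hl] at h1
      exact huv z h1
    · rw [if_neg hl, if_neg hl] at h1
      exact hc z h1.symm
end

theorem mainTheorem12 :
    (∀ (m n : ℕ) (G : Subgroup (Equiv.Perm (Fin m))) (H : Subgroup (Equiv.Perm (Fin n))),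
      HasEKR G (Fin m) → HasEKR H (Fin n) →
        HasEKR (WreathProduct G H (Fin n)) (Fin m × Fin n)) ∧
    (∀ m n : ℕ, 1 ≤ m → 1 ≤ n →
      HasEKR (WreathProduct (Equiv.Perm (Fin m)) (Equiv.Perm (Fin n)) (Fin n))
        (Fin m × Fin n)) ∧
    (∀ m n : ℕ, 4 ≤ m → 1 ≤ n →
      HasStrictEKR (WreathProduct (Equiv.Perm (Fin m)) (Equiv.Perm (Fin n)) (Fin n))
        (Fin m × Fin n)) := by
  have hEKR : ∀ m n : ℕ, 1 ≤ m → 1 ≤ n →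
      HasEKR (WreathProduct (Equiv.Perm (Fin m)) (Equiv.Perm (Fin n)) (Fin n))
        (Fin m × Fin n) := by
    intro m n hm hn
    have : NeZero m := ⟨by omega⟩
    have : NeZero n := ⟨by omega⟩
    exact (Equiv.Perm.hasEKR (Fin m)).wreathProduct (Equiv.Perm.hasEKR (Fin n))
  refine ⟨fun m n G H hG hH => hG.wreathProduct hH, hEKR, fun m n hm hn =>
    ⟨hEKR m n (by omega) hn, fun S hS => ?_⟩⟩
  have : NeZero m := ⟨by omega⟩
  have : NeZero n := ⟨by omega⟩
  have hne := hS.nonempty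
  obtain ⟨p, q, hpq⟩ := hS.exists_smul_eq (by simpa using hm) hne
  exact hS.eq_coset hne hpq
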